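/- Let $0<\beta<1$, $s:=1-\beta/2\in(\tfrac12,1)$, $a_0,a_1\in\mathbb R$, and let $f\in L^2(0,1)$ satisfy $\int_0^1 f\,dx+a_1-a_0=0$. For $\alpha>0$ let $${}_0I_x^{\alpha}w(x)=\frac1{\Gamma(\alpha)}\int_0^x\frac{w(t)}{(x-t)^{1-\alpha}}\,dt,\qquad {}_xI_1^{\alpha}w(x)=\frac1{\Gamma(\alpha)}\int_x^1\frac{w(t)}{(t-x)^{1-\alpha}}\,dt .$$ The Caputo derivatives of order $s$ are ${}^C_0D_x^{s}v={}_0I_x^{1-s}Dv$ and ${}^C_xD_1^{s}v=-\,{}_xI_1^{1-s}Dv$, understood weakly: $g\in L^2(0,1)$ equals ${}^C_0D_x^sv$ (respectively ${}^C_xD_1^sv$) if for all $\varphi\in C_0^\infty(0,1)$ $$\int_0^1 g\;{}_xI_1^{s}(-\varphi')\,dx=-\int_0^1 v\,\varphi'\,dx\qquad\Big(\text{respectively }\int_0^1 g\;{}_0I_x^{s}\varphi'\,dx=\int_0^1 v\,\varphi'\,dx\Big).$$ Let $H^{s}_{C,l}(0,1)$ be the space of all $v\in L^2(0,1)$ with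 ${}^C_0D_x^{s}v\in L^2(0,1)$. Its elements have a continuous representative on $[0,1]$, with which point values are taken, and have ${}^C_xD_1^{s}v\in L^2(0,1)$. Let $u\in H^{1-\beta/2}_{C,l}(0,1)$ be any weak solution of the conservative Caputo equation $-D({}^C_0D_x^{1-\beta}u)=f$ on $(0,1)$ with Caputo Neumann data $a_0,a_1$, i.e. $$-\int_0^1 {}^C_0D_x^{1-\beta/2}u\;\,{}^C_xD_1^{1-\beta/2}v\,dx=\int_0^1 f v\,dx+a_1v(1)-a_0v(0)\qquad\text{for all }v\in H^{1-\beta/2}_{C,l}(0,1).$$ Then, for the continuous representative of $u$, $$u(x)={}_0I_x^{1-\beta}w(x)+u(0)\qquad\text{for all }x\in[0,1],$$ where $w\in H^1(0,1)$ is the unique weak solution of the Dirichlet problem $-D^2w=Df$ on $(0,1)$, $w(0)=a_0$, $w(1)=a_1$ (that is, $\int_0^1 w'\varphi'\,dx=-\int_0^1 f\varphi'\,dx$ for all $\varphi\in C_0^\infty(0,1)$, with the stated boundary values). -/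

import Mathlib

open MeasureTheory Set
open scoped ContDiff

noncomputable section

namespace CaputoNeumann

/-- Lebesgue measure on the open unit interval. -/
def vol01 : Measure ℝ := volume.restrict (Ioo (0 : ℝ) 1)

/-- The left fractional integral of order `α`,
`(1 / Γ(α)) ∫₀ˣ w(s) (x - s)^(α - 1) ds`. -/
def leftFracInt (α : ℝ) (w : ℝ → ℝ) (x : ℝ) : ℝ :=
  1 / Real.Gamma α * ∫ s in (0 : ℝ)..x, w s / (x - s) ^ (1 - α)

/-- The right fractional integral of order `α`,
`(1 / Γ(α)) ∫ₓ¹ w(s) (s - x)^(α - 1) ds`. -/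
def rightFracInt (α : ℝ) (w : ℝ → ℝ) (x : ℝ) : ℝ :=
  1 / Real.Gamma α * ∫ s in x..(1 : ℝ), w s / (s - x) ^ (1 - α)

/-- The classical left Caputo derivative of order `γ ∈ (0,1)` of a smooth function:
the left fractional integral of order `1 - γ` of `φ'`. -/
def leftCaputo (γ : ℝ) (φ : ℝ → ℝ) : ℝ → ℝ :=
  leftFracInt (1 - γ) (deriv φ)

/-- The classical right Caputo derivative of order `γ ∈ (0,1)` of a smooth function:
the right fractional integral of order `1 - γ` of `-φ'`. -/
def rightCaputo (γ : ℝ) (φ : ℝ → ℝ) : ℝ → ℝ :=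
  rightFracInt (1 - γ) (fun s => -deriv φ s)

/-- `φ ∈ C₀^∞(0,1)`. -/
structure IsTestFunction (φ : ℝ → ℝ) : Prop where
  smooth : ContDiff ℝ ∞ φ
  compact : HasCompactSupport φ
  support : tsupport φ ⊆ Ioo (0 : ℝ) 1

/-- `g ∈ L²(0,1)` is the left Caputo derivative `I^(1-μ) D v` (`I` the left fractional
integral, `D` the weak derivative) of `v`, of order `μ`.  Every test function `φ` is the right
fractional integral of order `1 - μ` of its right Caputo derivative of order `1 - μ`, so that
the adjointness of the left and right fractional integrals turns `g = I^(1-μ) D v` into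
`∫ g (right Caputo derivative of φ) = ⟨D v, φ⟩ = - ∫ v φ'`.
For `1/2 < μ < 1` the function `g` is determined by `v` almost everywhere. -/
structure HasLeftCaputoDeriv (μ : ℝ) (v g : ℝ → ℝ) : Prop where
  memLp : MemLp g 2 vol01
  weak : ∀ φ : ℝ → ℝ, IsTestFunction φ →
    ∫ x, g x * rightCaputo (1 - μ) φ x ∂vol01 = -∫ x, v x * deriv φ x ∂vol01

/-- `h ∈ L²(0,1)` is the right Caputo derivative `I^(1-μ) (-D v)` (`I` the right fractional
integral, `D` the weak derivative) of `v`, of order `μ`; by the mirrored duality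
`∫ h (left Caputo derivative of φ) = ⟨- D v, φ⟩ = ∫ v φ'`. -/
structure HasRightCaputoDeriv (μ : ℝ) (v h : ℝ → ℝ) : Prop where
  memLp : MemLp h 2 vol01
  weak : ∀ φ : ℝ → ℝ, IsTestFunction φ →
    ∫ x, h x * leftCaputo (1 - μ) φ x ∂vol01 = ∫ x, v x * deriv φ x ∂vol01

/-- The left Caputo space of order `μ ∈ (1/2, 1)`: functions in `L²(0,1)` whose left Caputo
derivative of order `μ` is in `L²(0,1)`. -/
def MemLeftCaputoSpace (μ : ℝ) (v : ℝ → ℝ) : Prop :=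
  MemLp v 2 vol01 ∧ ∃ g : ℝ → ℝ, HasLeftCaputoDeriv μ v g

/-- `vc` is the continuous representative on `[0,1]` of the (class of the) function `v`;
its values at `0` and `1` are the boundary values `v(0)` and `v(1)`. -/
structure IsContRep (v vc : ℝ → ℝ) : Prop where
  cont : ContinuousOn vc (Icc (0 : ℝ) 1)
  ae_eq : v =ᵐ[vol01] vc

/-- Weak solutions `u` of the conservative Caputo equation of order `2 - β` with the Caputo
Neumann boundary data `a₀`, `a₁`: `u` lies in the left Caputo space of order `1 - β/2`, and
`-(g, h) = (f, v) + a₁ v(1) - a₀ v(0)` for all `v` in that space, where `g` is the left Caputo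
derivative of `u` and `h` the right Caputo derivative of `v`, both of order `1 - β/2`.
For orders in `(1/2, 1)` every `v` in the left Caputo space has exactly one continuous
representative and, up to null sets, exactly one right Caputo derivative in `L²(0,1)`. -/
def IsWeakSolution (β : ℝ) (f : ℝ → ℝ) (a₀ a₁ : ℝ) (u : ℝ → ℝ) : Prop :=
  MemLp u 2 vol01 ∧
  ∃ g : ℝ → ℝ, HasLeftCaputoDeriv (1 - β / 2) u g ∧
    ∀ v vc h : ℝ → ℝ, MemLeftCaputoSpace (1 - β / 2) v → IsContRep v vc →
      HasRightCaputoDeriv (1 - β / 2) v h →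
      -∫ x, g x * h x ∂vol01 = (∫ x, f x * v x ∂vol01) + a₁ * vc 1 - a₀ * vc 0

/-- `w ∈ H¹(0,1)` with weak derivative `dw`. -/
structure HasH1Deriv (w dw : ℝ → ℝ) : Prop where
  memLp : MemLp w 2 vol01
  memLp_deriv : MemLp dw 2 vol01
  weak : ∀ φ : ℝ → ℝ, IsTestFunction φ →
    ∫ x, dw x * φ x ∂vol01 = -∫ x, w x * deriv φ x ∂vol01

/-- `w ∈ H¹(0,1)` is a weak solution of `-D² w = D f` on `(0,1)`, `w(0) = a₀`, `w(1) = a₁`: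
`∫ w' φ' = - ∫ f φ'` for all test functions `φ`. -/
def IsDirichletSolution (f : ℝ → ℝ) (a₀ a₁ : ℝ) (w : ℝ → ℝ) : Prop :=
  (∃ dw : ℝ → ℝ, HasH1Deriv w dw ∧ ∀ φ : ℝ → ℝ, IsTestFunction φ →
    ∫ x, dw x * deriv φ x ∂vol01 = -∫ x, f x * deriv φ x ∂vol01) ∧
  ∃ wc : ℝ → ℝ, IsContRep w wc ∧ wc 0 = a₀ ∧ wc 1 = a₁

end CaputoNeumann

end

namespace CaputoNeumann

/-! The Dirichlet problem is solved by W(x) = a₁ + ∫ₓ¹ f, and the constraint on the data says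
exactly that W(0) = a₀. It remains to see that u differs from I^(1-β) W by a constant (I, J denote
the left and right fractional integrals).

Given a test function φ, put ψ = J^(1-β) φ' and use the primitive v = I^1 ψ in the weak equation. By
the semigroup law the right Caputo derivative of v is -J^(1-β/2) φ', the function against which the
derivative of u is tested in its own definition. The left side is therefore ∫ u φ'. Since v(0) = 0
and v(1) = ∫ ψ, the right side is ∫ W ψ, which equals ∫ (I^(1-β) W) φ' by adjointness. The du
Bois-Reymond lemma gives the constant, and evaluation at 0 identifies it.

The tools are adjointness (`integral_leftFracInt_mul`), the semigroup law
(`rightFracInt_rightFracInt`) and the Caputo derivatives of primitives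
(`hasLeftCaputoDeriv_primitive`, `hasRightCaputoDeriv_primitive`). -/

/-! ### The fractional kernel: Beta integral, marginals, composition. -/

theorem integral_rpow_mul_rpow_sub {α β a : ℝ} (hα : 0 < α) (hβ : 0 < β) (ha : 0 < a) :
    ∫ x in (0 : ℝ)..a, x ^ (α - 1) * (a - x) ^ (β - 1) =
      a ^ (α + β - 1) * (Real.Gamma α * Real.Gamma β / Real.Gamma (α + β)) := by
  have h := Complex.betaIntegral_scaled (α : ℂ) (β : ℂ) ha
  have hβI : Complex.betaIntegral α β =
      ((Real.Gamma α * Real.Gamma β / Real.Gamma (α + β) : ℝ) : ℂ) := by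
    rw [Complex.betaIntegral_eq_Gamma_mul_div (α : ℂ) (β : ℂ) (by simpa) (by simpa)]
    simp_rw [← Complex.ofReal_add, Complex.Gamma_ofReal]
    norm_cast
  have hL : ∫ x in (0 : ℝ)..a, (x : ℂ) ^ ((α : ℂ) - 1) * ((a : ℂ) - x) ^ ((β : ℂ) - 1) =
      ((∫ x in (0 : ℝ)..a, x ^ (α - 1) * (a - x) ^ (β - 1) : ℝ) : ℂ) := by
    rw [← intervalIntegral.integral_ofReal]
    refine intervalIntegral.integral_congr fun x hx => ?_
    rw [uIcc_of_le ha.le] at hx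
    simp only [Complex.ofReal_mul]
    rw [Complex.ofReal_cpow hx.1, Complex.ofReal_cpow (sub_nonneg.2 hx.2)]
    push_cast
    rfl
  rw [hL, hβI] at h
  have h2 : (a : ℂ) ^ ((α : ℂ) + β - 1) = ((a ^ (α + β - 1) : ℝ) : ℂ) := by
    rw [Complex.ofReal_cpow ha.le]; push_cast; rfl
  rw [h2] at h
  exact_mod_cast h

/-- The convolution kernel of the fractional integrals. -/
noncomputable def fracKernel (α x y : ℝ) : ℝ :=
  if y < x then (x - y) ^ (α - 1) / Real.Gamma α else 0

theorem measurable_fracKernel (α : ℝ) : Measurable fun p : ℝ × ℝ => fracKernel α p.1 p.2 := by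
  unfold fracKernel
  exact Measurable.ite (measurableSet_lt measurable_snd measurable_fst) (by fun_prop) (by fun_prop)

theorem fracKernel_nonneg {α : ℝ} (hα : 0 < α) (x y : ℝ) : 0 ≤ fracKernel α x y := by
  unfold fracKernel
  split_ifs with h
  · exact div_nonneg (Real.rpow_nonneg (sub_nonneg.2 h.le) _) (Real.Gamma_pos_of_pos hα).le
  · exact le_rfl

instance : IsFiniteMeasure vol01 := by unfold vol01; infer_instance

theorem integral_vol01_indicator_Iio {x : ℝ} (hx : x ∈ Icc (0 : ℝ) 1) (F : ℝ → ℝ) :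
    ∫ y, (Iio x).indicator F y ∂vol01 = ∫ y in (0 : ℝ)..x, F y := by
  rw [integral_indicator measurableSet_Iio, vol01, Measure.restrict_restrict measurableSet_Iio,
    intervalIntegral.integral_of_le hx.1, integral_Ioc_eq_integral_Ioo]
  congr 2
  ext y
  simp only [mem_inter_iff, mem_Iio, mem_Ioo]
  have := hx.2
  constructor
  · rintro ⟨h1, h2, h3⟩; exact ⟨h2, h1⟩
  · rintro ⟨h1, h2⟩; exact ⟨h2, h1, by linarith⟩

theorem integral_vol01_indicator_Ioi {x : ℝ} (hx : x ∈ Icc (0 : ℝ) 1) (F : ℝ → ℝ) :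
    ∫ y, (Ioi x).indicator F y ∂vol01 = ∫ y in x..(1 : ℝ), F y := by
  rw [integral_indicator measurableSet_Ioi, vol01, Measure.restrict_restrict measurableSet_Ioi,
    intervalIntegral.integral_of_le hx.2, integral_Ioc_eq_integral_Ioo]
  congr 2
  ext y
  simp only [mem_inter_iff, mem_Ioi, mem_Ioo]
  have := hx.1
  constructor
  · rintro ⟨h1, h2, h3⟩; exact ⟨h1, h3⟩
  · rintro ⟨h1, h2⟩; exact ⟨h1, by linarith, h2⟩

/-- With the kernel extended by zero, left and right integrals are transposes of each other on a
fixed domain, so adjointness becomes Fubini. -/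
theorem leftFracInt_eq_integral_fracKernel (α : ℝ) (w : ℝ → ℝ) {x : ℝ} (hx : x ∈ Icc (0 : ℝ) 1) :
    leftFracInt α w x = ∫ y, fracKernel α x y * w y ∂vol01 := by
  rw [leftFracInt, ← integral_vol01_indicator_Iio hx, ← integral_const_mul]
  congr 1
  ext y
  by_cases h : y < x
  · rw [indicator_of_mem (mem_Iio.2 h), fracKernel, if_pos h, show α - 1 = -(1 - α) by ring,
      Real.rpow_neg (sub_nonneg.2 h.le)]
    ring
  · rw [indicator_of_notMem (by simpa using h), fracKernel, if_neg h]
    ring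

theorem rightFracInt_eq_integral_fracKernel (α : ℝ) (w : ℝ → ℝ) {x : ℝ} (hx : x ∈ Icc (0 : ℝ) 1) :
    rightFracInt α w x = ∫ y, fracKernel α y x * w y ∂vol01 := by
  rw [rightFracInt, ← integral_vol01_indicator_Ioi hx, ← integral_const_mul]
  congr 1
  ext y
  by_cases h : x < y
  · rw [indicator_of_mem (mem_Ioi.2 h), fracKernel, if_pos h, show α - 1 = -(1 - α) by ring,
      Real.rpow_neg (sub_nonneg.2 h.le)]
    ring
  · rw [indicator_of_notMem (by simpa using h), fracKernel, if_neg h]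
    ring

theorem fracKernel_eq_indicator (α x : ℝ) : (fun y => fracKernel α x y) =
    (Iio x).indicator fun y => (x - y) ^ (α - 1) / Real.Gamma α := by
  ext y
  by_cases h : y < x <;> simp [fracKernel, h]

theorem fracKernel_eq_indicator' (α y : ℝ) : (fun x => fracKernel α x y) =
    (Ioi y).indicator fun x => (x - y) ^ (α - 1) / Real.Gamma α := by
  ext x
  by_cases h : y < x <;> simp [fracKernel, h]

theorem integrable_fracKernel {α : ℝ} (hα : 0 < α) {x : ℝ} (hx : x ∈ Icc (0 : ℝ) 1) :
    Integrable (fun y => fracKernel α x y) vol01 := by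
  rw [fracKernel_eq_indicator, integrable_indicator_iff measurableSet_Iio, vol01, IntegrableOn,
    Measure.restrict_restrict measurableSet_Iio]
  have h : IntervalIntegrable (fun y => y ^ (α - 1)) volume (x - 0) (x - x) :=
    intervalIntegral.intervalIntegrable_rpow' (by linarith)
  have h2 := (h.comp_sub_left x).div_const (Real.Gamma α)
  simp only [sub_sub_cancel] at h2
  refine ((intervalIntegrable_iff_integrableOn_Ioc_of_le hx.1).1 h2).mono_set ?_
  rintro y ⟨h1, h3, h4⟩
  exact ⟨h3, le_of_lt h1⟩

theorem integrable_fracKernel' {α : ℝ} (hα : 0 < α) {y : ℝ} (hy : y ∈ Icc (0 : ℝ) 1) :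
    Integrable (fun x => fracKernel α x y) vol01 := by
  rw [fracKernel_eq_indicator', integrable_indicator_iff measurableSet_Ioi, vol01, IntegrableOn,
    Measure.restrict_restrict measurableSet_Ioi]
  have h : IntervalIntegrable (fun y => y ^ (α - 1)) volume (y - y) (1 - y) :=
    intervalIntegral.intervalIntegrable_rpow' (by linarith)
  have h2 := (h.comp_sub_right y).div_const (Real.Gamma α)
  simp only [sub_add_cancel] at h2
  refine ((intervalIntegrable_iff_integrableOn_Ioc_of_le hy.2).1 h2).mono_set ?_
  rintro x ⟨h1, h3, h4⟩
  exact ⟨h1, le_of_lt h4⟩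

/-- The integral is x^α / (α Γ(α)), largest at x = 1. -/
theorem integral_fracKernel_le {α : ℝ} (hα : 0 < α) {x : ℝ} (hx : x ∈ Icc (0 : ℝ) 1) :
    ∫ y, fracKernel α x y ∂vol01 ≤ 1 / (α * Real.Gamma α) := by
  have hΓ := Real.Gamma_pos_of_pos hα
  rw [fracKernel_eq_indicator, integral_vol01_indicator_Iio hx, intervalIntegral.integral_div,
    intervalIntegral.integral_comp_sub_left (fun y => y ^ (α - 1)), sub_self, sub_zero,
    integral_rpow (Or.inl (by linarith)), sub_add_cancel, Real.zero_rpow hα.ne', sub_zero, div_div]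
  gcongr
  exact Real.rpow_le_one hx.1 hx.2 hα.le

theorem integral_fracKernel_le' {α : ℝ} (hα : 0 < α) {y : ℝ} (hy : y ∈ Icc (0 : ℝ) 1) :
    ∫ x, fracKernel α x y ∂vol01 ≤ 1 / (α * Real.Gamma α) := by
  have hΓ := Real.Gamma_pos_of_pos hα
  rw [fracKernel_eq_indicator', integral_vol01_indicator_Ioi hy, intervalIntegral.integral_div,
    intervalIntegral.integral_comp_sub_right (fun y => y ^ (α - 1)), sub_self,
    integral_rpow (Or.inl (by linarith)), sub_add_cancel, Real.zero_rpow hα.ne', sub_zero, div_div]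
  gcongr
  exact Real.rpow_le_one (by linarith [hy.2]) (by linarith [hy.1]) hα.le

/-- The product lives on z < y < x, where translation by z gives a Beta integral; this is the
semigroup law at the level of kernels. -/
theorem integral_fracKernel_mul_fracKernel {α β : ℝ} (hα : 0 < α) (hβ : 0 < β) {x z : ℝ}
    (hx : x ∈ Icc (0 : ℝ) 1) (hz : z ∈ Icc (0 : ℝ) 1) :
    ∫ y, fracKernel α x y * fracKernel β y z ∂vol01 = fracKernel (α + β) x z := by
  by_cases h : z < x
  · have hα' := (Real.Gamma_pos_of_pos hα).ne'
    have hβ' := (Real.Gamma_pos_of_pos hβ).ne'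
    have e : (fun y => fracKernel α x y * fracKernel β y z) = (Iio x).indicator
        ((Ioi z).indicator fun y => (x - y) ^ (α - 1) / Real.Gamma α *
          ((y - z) ^ (β - 1) / Real.Gamma β)) := by
      ext y
      by_cases h1 : y < x <;> by_cases h2 : z < y <;> simp [fracKernel, h1, h2]
    rw [e, integral_indicator measurableSet_Iio, integral_indicator measurableSet_Ioi, vol01,
      Measure.restrict_restrict measurableSet_Iio, Measure.restrict_restrict measurableSet_Ioi]
    have s : Ioi z ∩ (Iio x ∩ Ioo (0 : ℝ) 1) = Ioo z x := by
      ext y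
      simp only [mem_inter_iff, mem_Ioi, mem_Iio, mem_Ioo]
      have := hx.2
      have := hz.1
      constructor
      · rintro ⟨h1, h2, h3⟩; exact ⟨h1, h2⟩
      · rintro ⟨h1, h2⟩; exact ⟨h1, h2, by linarith, by linarith⟩
    rw [s, ← integral_Ioc_eq_integral_Ioo, ← intervalIntegral.integral_of_le h.le]
    have key := integral_rpow_mul_rpow_sub hβ hα (sub_pos.2 h)
    have sub := intervalIntegral.integral_comp_sub_right (a := z) (b := x)
      (fun t => t ^ (β - 1) * (x - z - t) ^ (α - 1)) z
    rw [sub_self, key] at sub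
    have e2 : ∀ y, (x - y) ^ (α - 1) / Real.Gamma α * ((y - z) ^ (β - 1) / Real.Gamma β) =
        (Real.Gamma α * Real.Gamma β)⁻¹ * ((y - z) ^ (β - 1) * (x - z - (y - z)) ^ (α - 1)) := by
      intro y
      rw [sub_sub_sub_cancel_right]
      field_simp
    simp_rw [e2]
    rw [intervalIntegral.integral_const_mul, sub, fracKernel, if_pos h, add_comm β α]
    have := (Real.Gamma_pos_of_pos (add_pos hα hβ)).ne'
    field_simp
  · have e : ∀ y, fracKernel α x y * fracKernel β y z = 0 := by
      intro y
      by_cases h1 : y < x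
      · have : ¬ z < y := fun h2 => h (h2.trans h1)
        simp [fracKernel, this]
      · simp [fracKernel, h1]
    simp_rw [e]
    simp [fracKernel, h]

/-! ### Adjointness, boundedness, semigroup law and continuity of fractional integrals. -/

/-- Fubini's theorem for a nonnegative kernel with uniformly bounded marginals, applied to a
bounded and an integrable function. -/
theorem integral_integral_kernel_swap {μ : Measure ℝ} [IsFiniteMeasure μ] {k : ℝ → ℝ → ℝ}
    (hk : Measurable fun p : ℝ × ℝ => k p.1 p.2) (hk0 : ∀ x y, 0 ≤ k x y) {C : ℝ}
    (hki : ∀ᵐ x ∂μ, Integrable (k x) μ) (hkC : ∀ᵐ x ∂μ, ∫ y, k x y ∂μ ≤ C)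
    {a b : ℝ → ℝ} {M : ℝ} (ha : AEStronglyMeasurable a μ) (haM : ∀ᵐ x ∂μ, |a x| ≤ M)
    (hb : Integrable b μ) :
    ∫ x, (∫ y, k x y * a y ∂μ) * b x ∂μ = ∫ y, a y * ∫ x, k x y * b x ∂μ ∂μ := by
  -- For nonzero μ the bound |a| ≤ M holds at some point, which forces 0 ≤ M below.
  rcases eq_zero_or_neZero μ with rfl | hμ
  · simp
  have hm : AEStronglyMeasurable (fun p : ℝ × ℝ => k p.1 p.2 * a p.2 * b p.1) (μ.prod μ) :=
    (hk.aestronglyMeasurable.mul ha.comp_snd).mul hb.1.comp_fst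
  have hka : ∀ᵐ x ∂μ, Integrable (fun y => k x y * a y) μ := by
    filter_upwards [hki] with x hx
    exact hx.mul_bdd (c := M) ha (by simpa using haM)
  have hI : Integrable (fun p : ℝ × ℝ => k p.1 p.2 * a p.2 * b p.1) (μ.prod μ) := by
    rw [integrable_prod_iff hm]
    constructor
    · filter_upwards [hka] with x hx
      exact hx.mul_const _
    · refine (hb.norm.const_mul (M * C)).mono' hm.norm.integral_prod_right' ?_
      filter_upwards [hki, hkC, hka] with x h1 h2 h3
      rw [Real.norm_of_nonneg (integral_nonneg fun _ => norm_nonneg _)]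
      simp_rw [norm_mul]
      rw [integral_mul_const]
      refine mul_le_mul_of_nonneg_right ?_ (norm_nonneg _)
      obtain ⟨y, hy⟩ := haM.exists
      have hM : 0 ≤ M := (abs_nonneg _).trans hy
      calc ∫ y, ‖k x y‖ * ‖a y‖ ∂μ ≤ ∫ y, M * k x y ∂μ := by
            refine integral_mono_ae (by simpa using h3.norm) (h1.const_mul M) ?_
            filter_upwards [haM] with y hy
            rw [Real.norm_of_nonneg (hk0 x y), mul_comm]
            exact mul_le_mul_of_nonneg_right hy (hk0 x y)
        _ = M * ∫ y, k x y ∂μ := integral_const_mul _ _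
        _ ≤ M * C := mul_le_mul_of_nonneg_left h2 hM
  calc ∫ x, (∫ y, k x y * a y ∂μ) * b x ∂μ = ∫ x, ∫ y, k x y * a y * b x ∂μ ∂μ := by
        simp_rw [integral_mul_const]
    _ = ∫ y, ∫ x, k x y * a y * b x ∂μ ∂μ := integral_integral_swap hI
    _ = _ := by
        congr 1; ext y
        rw [← integral_const_mul]
        congr 1; ext x; ring

theorem ae_vol01_mem_Icc : ∀ᵐ x ∂vol01, x ∈ Icc (0 : ℝ) 1 := by
  filter_upwards [ae_restrict_mem (measurableSet_Ioo (a := (0 : ℝ)) (b := 1))] with x hx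
  exact Ioo_subset_Icc_self hx

theorem exists_ae_abs_le_of_memLp_top {a : ℝ → ℝ} (ha : MemLp a ⊤ vol01) :
    ∃ M, ∀ᵐ x ∂vol01, |a x| ≤ M := by
  refine ⟨(eLpNorm a ⊤ vol01).toReal, ?_⟩
  have h := ae_le_eLpNormEssSup (f := a) (μ := vol01)
  have hfin : eLpNorm a ⊤ vol01 ≠ ⊤ := ha.2.ne
  filter_upwards [h] with x hx
  rw [← eLpNorm_exponent_top] at hx
  have := (ENNReal.toReal_le_toReal (by simp) hfin).2 hx
  simpa using this

theorem leftFracInt_ae_eq (α : ℝ) (w : ℝ → ℝ) :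
    leftFracInt α w =ᵐ[vol01] fun x => ∫ y, fracKernel α x y * w y ∂vol01 := by
  filter_upwards [ae_vol01_mem_Icc] with x hx
  exact leftFracInt_eq_integral_fracKernel α w hx

theorem rightFracInt_ae_eq (α : ℝ) (w : ℝ → ℝ) :
    rightFracInt α w =ᵐ[vol01] fun x => ∫ y, fracKernel α y x * w y ∂vol01 := by
  filter_upwards [ae_vol01_mem_Icc] with x hx
  exact rightFracInt_eq_integral_fracKernel α w hx

theorem integral_leftFracInt_mul {α : ℝ} (hα : 0 < α) {a b : ℝ → ℝ} (ha : MemLp a ⊤ vol01)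
    (hb : Integrable b vol01) :
    ∫ x, leftFracInt α a x * b x ∂vol01 = ∫ x, a x * rightFracInt α b x ∂vol01 := by
  obtain ⟨M, hM⟩ := exists_ae_abs_le_of_memLp_top ha
  refine (integral_congr_ae ((leftFracInt_ae_eq α a).mul (ae_eq_refl b))).trans (Eq.trans ?_
    (integral_congr_ae ((ae_eq_refl a).mul (rightFracInt_ae_eq α b))).symm)
  exact integral_integral_kernel_swap (measurable_fracKernel α) (fracKernel_nonneg hα)
    (ae_vol01_mem_Icc.mono fun x hx => integrable_fracKernel hα hx)
    (ae_vol01_mem_Icc.mono fun x hx => integral_fracKernel_le hα hx) ha.1 hM hb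

theorem integral_rightFracInt_mul {α : ℝ} (hα : 0 < α) {a b : ℝ → ℝ} (ha : MemLp a ⊤ vol01)
    (hb : Integrable b vol01) :
    ∫ x, rightFracInt α a x * b x ∂vol01 = ∫ x, a x * leftFracInt α b x ∂vol01 := by
  obtain ⟨M, hM⟩ := exists_ae_abs_le_of_memLp_top ha
  refine (integral_congr_ae ((rightFracInt_ae_eq α a).mul (ae_eq_refl b))).trans (Eq.trans ?_
    (integral_congr_ae ((ae_eq_refl a).mul (leftFracInt_ae_eq α b))).symm)
  exact integral_integral_kernel_swap (k := fun x y => fracKernel α y x)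
    ((measurable_fracKernel α).comp measurable_swap) (fun x y => fracKernel_nonneg hα y x)
    (ae_vol01_mem_Icc.mono fun x hx => integrable_fracKernel' hα hx)
    (ae_vol01_mem_Icc.mono fun x hx => integral_fracKernel_le' hα hx) ha.1 hM hb

theorem abs_integral_mul_le {k a : ℝ → ℝ} {M C : ℝ} (hk : Integrable k vol01) (hk0 : ∀ x, 0 ≤ k x)
    (hC : ∫ x, k x ∂vol01 ≤ C) (hM : ∀ᵐ x ∂vol01, |a x| ≤ M) (hM0 : 0 ≤ M) :
    |∫ x, k x * a x ∂vol01| ≤ M * C := by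
  calc |∫ x, k x * a x ∂vol01| ≤ ∫ x, M * k x ∂vol01 := by
        rw [← Real.norm_eq_abs]
        refine norm_integral_le_of_norm_le (hk.const_mul M) ?_
        filter_upwards [hM] with x hx
        rw [norm_mul, Real.norm_of_nonneg (hk0 x), mul_comm]
        exact mul_le_mul_of_nonneg_right hx (hk0 x)
    _ = M * ∫ x, k x ∂vol01 := integral_const_mul _ _
    _ ≤ M * C := mul_le_mul_of_nonneg_left hC hM0

theorem memLp_top_leftFracInt {α : ℝ} (hα : 0 < α) {a : ℝ → ℝ} (ha : MemLp a ⊤ vol01) :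
    MemLp (leftFracInt α a) ⊤ vol01 := by
  obtain ⟨M, hM⟩ := exists_ae_abs_le_of_memLp_top ha
  have hm : AEStronglyMeasurable (fun p : ℝ × ℝ => fracKernel α p.1 p.2 * a p.2)
      (vol01.prod vol01) := (measurable_fracKernel α).aestronglyMeasurable.mul ha.1.comp_snd
  refine (memLp_congr_ae (leftFracInt_ae_eq α a)).2
    (memLp_top_of_bound hm.integral_prod_right' (max M 0 * (1 / (α * Real.Gamma α))) ?_)
  filter_upwards [ae_vol01_mem_Icc] with x hx
  exact abs_integral_mul_le (integrable_fracKernel hα hx) (fracKernel_nonneg hα x)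
    (integral_fracKernel_le hα hx) (hM.mono fun x hx => hx.trans (le_max_left _ _))
    (le_max_right _ _)

theorem memLp_top_rightFracInt {α : ℝ} (hα : 0 < α) {a : ℝ → ℝ} (ha : MemLp a ⊤ vol01) :
    MemLp (rightFracInt α a) ⊤ vol01 := by
  obtain ⟨M, hM⟩ := exists_ae_abs_le_of_memLp_top ha
  have hm : AEStronglyMeasurable (fun p : ℝ × ℝ => fracKernel α p.2 p.1 * a p.2)
      (vol01.prod vol01) :=
    ((measurable_fracKernel α).comp measurable_swap).aestronglyMeasurable.mul ha.1.comp_snd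
  refine (memLp_congr_ae (rightFracInt_ae_eq α a)).2
    (memLp_top_of_bound hm.integral_prod_right' (max M 0 * (1 / (α * Real.Gamma α))) ?_)
  filter_upwards [ae_vol01_mem_Icc] with x hx
  exact abs_integral_mul_le (integrable_fracKernel' hα hx) (fun y => fracKernel_nonneg hα y x)
    (integral_fracKernel_le' hα hx) (hM.mono fun x hx => hx.trans (le_max_left _ _))
    (le_max_right _ _)

/-- Adjointness is applied with the integrable kernel section at x as second function, so the law
holds at every point, not just almost everywhere. -/
theorem leftFracInt_leftFracInt {α β : ℝ} (hα : 0 < α) (hβ : 0 < β) {w : ℝ → ℝ}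
    (hw : MemLp w ⊤ vol01) {x : ℝ} (hx : x ∈ Icc (0 : ℝ) 1) :
    leftFracInt α (leftFracInt β w) x = leftFracInt (α + β) w x := by
  rw [leftFracInt_eq_integral_fracKernel _ _ hx, leftFracInt_eq_integral_fracKernel _ _ hx]
  simp_rw [mul_comm (fracKernel α x _)]
  rw [integral_leftFracInt_mul hβ hw (integrable_fracKernel hα hx)]
  refine integral_congr_ae ?_
  filter_upwards [ae_vol01_mem_Icc] with z hz
  rw [rightFracInt_eq_integral_fracKernel _ _ hz]
  simp_rw [mul_comm (fracKernel β _ z)]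
  rw [integral_fracKernel_mul_fracKernel hα hβ hx hz, mul_comm]

theorem rightFracInt_rightFracInt {α β : ℝ} (hα : 0 < α) (hβ : 0 < β) {w : ℝ → ℝ}
    (hw : MemLp w ⊤ vol01) {x : ℝ} (hx : x ∈ Icc (0 : ℝ) 1) :
    rightFracInt α (rightFracInt β w) x = rightFracInt (α + β) w x := by
  rw [rightFracInt_eq_integral_fracKernel _ _ hx, rightFracInt_eq_integral_fracKernel _ _ hx]
  simp_rw [mul_comm (fracKernel α _ x)]
  rw [integral_rightFracInt_mul hβ hw (integrable_fracKernel' hα hx)]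
  refine integral_congr_ae ?_
  filter_upwards [ae_vol01_mem_Icc] with z hz
  rw [leftFracInt_eq_integral_fracKernel _ _ hz,
    integral_fracKernel_mul_fracKernel hβ hα hz hx, mul_comm, add_comm]

theorem leftFracInt_one (w : ℝ → ℝ) (x : ℝ) : leftFracInt 1 w x = ∫ s in (0 : ℝ)..x, w s := by
  simp [leftFracInt]

theorem rightFracInt_one (w : ℝ → ℝ) (x : ℝ) : rightFracInt 1 w x = ∫ s in x..(1 : ℝ), w s := by
  simp [rightFracInt]

theorem rightFracInt_neg (α : ℝ) (w : ℝ → ℝ) (x : ℝ) :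
    rightFracInt α (fun s => -w s) x = -rightFracInt α w x := by
  simp [rightFracInt, neg_div]

/-- The substitution s = x t moves the singularity to the fixed point t = 1 and leaves a factor x^α;
dominated convergence then applies. -/
theorem continuousOn_leftFracInt {α : ℝ} (hα : 0 < α) {w : ℝ → ℝ}
    (hw : ContinuousOn w (Icc 0 1)) :
    ContinuousOn (leftFracInt α w) (Icc 0 1) := by
  have key : ∀ x ∈ Icc (0 : ℝ) 1,
      leftFracInt α w x = x ^ α * ∫ t, fracKernel α 1 t * w (x * t) ∂vol01 := by
    intro x hx
    rw [← leftFracInt_eq_integral_fracKernel α (fun t => w (x * t)) (by simp), leftFracInt,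
      leftFracInt]
    rcases hx.1.eq_or_lt with rfl | h0
    · simp [Real.zero_rpow hα.ne']
    have h := intervalIntegral.smul_integral_comp_mul_left (a := 0) (b := 1)
      (fun s => w s / (x - s) ^ (1 - α)) x
    rw [mul_zero, mul_one] at h
    rw [← h, smul_eq_mul, mul_left_comm (x ^ α)]
    congr 1
    rw [← intervalIntegral.integral_const_mul, ← intervalIntegral.integral_const_mul]
    refine intervalIntegral.integral_congr fun t ht => ?_
    rw [uIcc_of_le zero_le_one] at ht
    have e : x - x * t = x * (1 - t) := by ring
    have e2 : x ^ α = x / x ^ (1 - α) := by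
      rw [Real.rpow_sub h0, Real.rpow_one]
      have := (Real.rpow_pos_of_pos h0 α).ne'
      field_simp
    rw [e, Real.mul_rpow h0.le (sub_nonneg.2 ht.2), e2]
    ring
  refine ContinuousOn.congr ?_ key
  refine (Real.continuous_rpow_const hα.le).continuousOn.mul ?_
  obtain ⟨M, hM⟩ := isCompact_Icc.exists_bound_of_continuousOn hw
  have hmem : ∀ {x t : ℝ}, x ∈ Icc (0 : ℝ) 1 → t ∈ Icc (0 : ℝ) 1 → x * t ∈ Icc (0 : ℝ) 1 :=
    fun hx ht => ⟨mul_nonneg hx.1 ht.1, mul_le_one₀ hx.2 ht.1 ht.2⟩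
  have hK : Measurable fun t => fracKernel α 1 t :=
    (measurable_fracKernel α).comp measurable_prodMk_left
  refine MeasureTheory.continuousOn_of_dominated (bound := fun t => fracKernel α 1 t * M) ?_ ?_ ?_ ?_
  · intro x hx
    refine hK.aestronglyMeasurable.mul ?_
    have hc : ContinuousOn (fun t => w (x * t)) (Icc 0 1) :=
      hw.comp (by fun_prop) fun t ht => hmem hx ht
    exact (hc.mono Ioo_subset_Icc_self).aestronglyMeasurable measurableSet_Ioo
  · intro x hx
    filter_upwards [ae_vol01_mem_Icc] with t ht
    rw [norm_mul, Real.norm_of_nonneg (fracKernel_nonneg hα _ _)]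
    exact mul_le_mul_of_nonneg_left
      (hM _ (hmem hx ht)) (fracKernel_nonneg hα _ _)
  · exact (integrable_fracKernel hα (by simp)).mul_const M
  · filter_upwards [ae_vol01_mem_Icc] with t ht
    exact continuousOn_const.mul (hw.comp (by fun_prop) fun x hx => hmem hx ht)

/-! ### Test functions and the du Bois-Reymond lemma. -/

namespace IsTestFunction

variable {φ : ℝ → ℝ}

theorem continuous_deriv (h : IsTestFunction φ) : Continuous (deriv φ) :=
  h.smooth.continuous_deriv (by simp)

theorem memLp_top_deriv (h : IsTestFunction φ) : MemLp (deriv φ) ⊤ vol01 := by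
  obtain ⟨M, hM⟩ := h.continuous_deriv.bounded_above_of_compact_support h.compact.deriv
  exact memLp_top_of_bound h.continuous_deriv.aestronglyMeasurable M (Filter.Eventually.of_forall hM)

theorem memLp_top (h : IsTestFunction φ) : MemLp φ ⊤ vol01 := by
  obtain ⟨M, hM⟩ := h.smooth.continuous.bounded_above_of_compact_support h.compact
  exact memLp_top_of_bound h.smooth.continuous.aestronglyMeasurable M
    (Filter.Eventually.of_forall hM)

theorem eq_zero_of_notMem (h : IsTestFunction φ) {x : ℝ} (hx : x ∉ Ioo (0 : ℝ) 1) : φ x = 0 :=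
  image_eq_zero_of_notMem_tsupport fun hx' => hx (h.support hx')

theorem integral_deriv (h : IsTestFunction φ) (a b : ℝ) :
    ∫ x in a..b, deriv φ x = φ b - φ a :=
  intervalIntegral.integral_deriv_eq_sub
    (fun x _ => (h.smooth.differentiable (by simp)).differentiableAt)
    (h.continuous_deriv.intervalIntegrable _ _)

theorem leftFracInt_one_deriv (h : IsTestFunction φ) (x : ℝ) :
    leftFracInt 1 (deriv φ) x = φ x := by
  rw [leftFracInt_one, h.integral_deriv, h.eq_zero_of_notMem (x := 0) (by simp), sub_zero]

theorem rightFracInt_one_deriv (h : IsTestFunction φ) (x : ℝ) :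
    rightFracInt 1 (deriv φ) x = -φ x := by
  rw [rightFracInt_one, h.integral_deriv, h.eq_zero_of_notMem (x := 1) (by simp), zero_sub]

end IsTestFunction

theorem integral_vol01_eq_integral {F : ℝ → ℝ} (h : ∀ x ∉ Ioo (0 : ℝ) 1, F x = 0) :
    ∫ x, F x ∂vol01 = ∫ x, F x :=
  setIntegral_eq_integral_of_forall_compl_eq_zero h

theorem exists_isTestFunction_integral_eq_one :
    ∃ η : ℝ → ℝ, IsTestFunction η ∧ ∫ x, η x ∂vol01 = 1 := by
  let B : ContDiffBump (1 / 2 : ℝ) := ⟨1 / 8, 1 / 4, by norm_num, by norm_num⟩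
  have hB : IsTestFunction (B.normed volume) := by
    refine ⟨B.contDiff_normed, B.hasCompactSupport_normed, ?_⟩
    rw [B.tsupport_normed_eq, Real.closedBall_eq_Icc]
    intro x hx
    have h1 : (1 / 2 : ℝ) - 1 / 4 ≤ x := hx.1
    have h2 : x ≤ (1 / 2 : ℝ) + 1 / 4 := hx.2
    constructor <;> linarith
  refine ⟨_, hB, ?_⟩
  rw [integral_vol01_eq_integral fun x hx => hB.eq_zero_of_notMem hx]
  exact B.integral_normed

/-- The primitive from 0 vanishes to the left of the support of χ, and to its right because χ has
mean zero. -/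
theorem IsTestFunction.exists_primitive {χ : ℝ → ℝ} (h : IsTestFunction χ)
    (h0 : ∫ x, χ x ∂vol01 = 0) : ∃ φ, IsTestFunction φ ∧ deriv φ = χ := by
  obtain ⟨a, b, ha, hab, hb, hK⟩ : ∃ a b : ℝ, 0 < a ∧ a ≤ b ∧ b < 1 ∧ tsupport χ ⊆ Icc a b := by
    rcases (tsupport χ).eq_empty_or_nonempty with he | hne
    · exact ⟨1 / 2, 1 / 2, by norm_num, le_rfl, by norm_num, by simp [he]⟩
    · obtain ⟨a, ha⟩ := h.compact.isCompact.exists_isLeast hne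
      obtain ⟨b, hb⟩ := h.compact.isCompact.exists_isGreatest hne
      exact ⟨a, b, (h.support ha.1).1, ha.2 hb.1, (h.support hb.1).2,
        fun x hx => ⟨ha.2 hx, hb.2 hx⟩⟩
  have hz : ∀ x, x ∉ Icc a b → χ x = 0 := fun x hx =>
    image_eq_zero_of_notMem_tsupport fun hx' => hx (hK hx')
  have hc := h.smooth.continuous
  have hd : ∀ x, HasDerivAt (fun x => ∫ t in (0 : ℝ)..x, χ t) (χ x) x := fun x =>
    intervalIntegral.integral_hasDerivAt_right (hc.intervalIntegrable _ _)
      (hc.stronglyMeasurableAtFilter _ _) hc.continuousAt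
  have hderiv : deriv (fun x => ∫ t in (0 : ℝ)..x, χ t) = χ := funext fun x => (hd x).deriv
  have hI : ∫ t in (0 : ℝ)..1, χ t = 0 := by
    rw [intervalIntegral.integral_of_le zero_le_one, integral_Ioc_eq_integral_Ioo]
    exact h0
  have hsupp : Function.support (fun x => ∫ t in (0 : ℝ)..x, χ t) ⊆ Icc a b := by
    intro x hx
    by_contra hx'
    apply hx
    rcases lt_or_ge x a with h1 | h1
    · refine (intervalIntegral.integral_congr (g := fun _ => 0) fun t ht => hz t fun ht' => ?_).trans
        (by simp)
      rcases le_total 0 x with h2 | h2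
      · rw [uIcc_of_le h2] at ht
        linarith [ht.2, ht'.1]
      · rw [uIcc_of_ge h2] at ht
        linarith [ht.2, ht'.1]
    · have h2 : b < x := by
        by_contra hbx
        exact hx' ⟨h1, not_lt.1 hbx⟩
      change ∫ t in (0 : ℝ)..x, χ t = 0
      rw [← intervalIntegral.integral_add_adjacent_intervals (hc.intervalIntegrable 0 1)
        (hc.intervalIntegrable 1 x), hI, zero_add]
      refine (intervalIntegral.integral_congr (g := fun _ => 0) fun t ht => hz t fun ht' => ?_).trans
        (by simp)
      rcases le_total 1 x with h3 | h3
      · rw [uIcc_of_le h3] at ht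
        linarith [ht.1, ht'.2]
      · rw [uIcc_of_ge h3] at ht
        linarith [ht.1, ht'.2]
  refine ⟨fun x => ∫ t in (0 : ℝ)..x, χ t, ⟨?_, ?_, ?_⟩, hderiv⟩
  · rw [contDiff_infty_iff_deriv, hderiv]
    exact ⟨fun x => (hd x).differentiableAt, h.smooth⟩
  · exact HasCompactSupport.of_support_subset_isCompact isCompact_Icc hsupp
  · exact (closure_minimal hsupp isClosed_Icc).trans
      fun x hx => ⟨ha.trans_le hx.1, hx.2.trans_lt hb⟩

theorem integrable_mul_of_memLp_top {a b : ℝ → ℝ} (ha : Integrable a vol01)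
    (hb : MemLp b ⊤ vol01) : Integrable (fun x => a x * b x) vol01 := by
  obtain ⟨M, hM⟩ := exists_ae_abs_le_of_memLp_top hb
  exact ha.mul_bdd (c := M) hb.1 (by simpa using hM)

/-- The lemma of du Bois-Reymond. -/
theorem ae_eq_const_of_integral_mul_deriv_eq_zero {k : ℝ → ℝ} (hk : Integrable k vol01)
    (h : ∀ φ, IsTestFunction φ → ∫ x, k x * deriv φ x ∂vol01 = 0) :
    ∃ c, ∀ᵐ x ∂vol01, k x = c := by
  obtain ⟨η, hη, hη1⟩ := exists_isTestFunction_integral_eq_one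
  refine ⟨∫ x, k x * η x ∂vol01, ?_⟩
  set c := ∫ x, k x * η x ∂vol01 with hc
  have hloc : LocallyIntegrableOn (fun x => k x - c) (Ioo 0 1) volume :=
    (show IntegrableOn (fun x => k x - c) (Ioo 0 1) volume from
      hk.sub (integrable_const c)).locallyIntegrableOn
  have := isOpen_Ioo.ae_eq_zero_of_integral_contDiff_smul_eq_zero hloc ?_
  · rw [vol01, ae_restrict_iff' measurableSet_Ioo]
    filter_upwards [this] with x hx hx'
    exact sub_eq_zero.1 (hx hx')
  intro g hg1 hg2 hg3
  have hg : IsTestFunction g := ⟨hg1, hg2, hg3⟩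
  have hgi : Integrable g vol01 := hg.memLp_top.integrable le_top
  have hηi : Integrable η vol01 := hη.memLp_top.integrable le_top
  set m := ∫ x, g x ∂vol01 with hm
  -- Subtracting m η makes the mean zero, so this function is the derivative of a test function and
  -- may be used in the hypothesis.
  have hχ : IsTestFunction fun x => g x - m * η x := by
    refine ⟨hg.smooth.sub (contDiff_const.mul hη.smooth), hg.compact.sub hη.compact.mul_left, ?_⟩
    refine (tsupport_sub (f := g) (g := fun x => m * η x)).trans (union_subset hg.support ?_)
    exact (tsupport_mul_subset_right (f := fun _ => m) (g := η)).trans hη.support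
  obtain ⟨φ, hφ, hφ'⟩ := hχ.exists_primitive (by
    rw [integral_sub hgi (hηi.const_mul m), integral_const_mul, hη1]
    simp [hm])
  have h1 := h φ hφ
  rw [hφ'] at h1
  rw [← integral_vol01_eq_integral fun x hx => by simp [hg.eq_zero_of_notMem hx]]
  have e1 : ∀ x, k x * (g x - m * η x) = k x * g x - m * (k x * η x) := fun x => by ring
  simp_rw [e1] at h1
  rw [integral_sub (integrable_mul_of_memLp_top hk hg.memLp_top)
    ((integrable_mul_of_memLp_top hk hη.memLp_top).const_mul m), integral_const_mul, ← hc] at h1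
  have e2 : ∀ x, g x • (k x - c) = k x * g x - c * g x := fun x => by rw [smul_eq_mul]; ring
  simp_rw [e2]
  rw [integral_sub (integrable_mul_of_memLp_top hk hg.memLp_top) (hgi.const_mul c),
    integral_const_mul, ← hm, ← h1]
  ring

/-! ### Caputo derivatives of primitives of bounded functions. -/

/-- Both sides of the weak identity reduce to pairings with ψ by adjointness, and they agree since
J^(1-μ) J^μ = J^1. This makes primitives admissible in the weak equation. -/
theorem hasLeftCaputoDeriv_primitive {μ : ℝ} (hμ0 : 0 < μ) (hμ1 : μ < 1) {ψ : ℝ → ℝ}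
    (hψ : MemLp ψ ⊤ vol01) :
    HasLeftCaputoDeriv μ (leftFracInt 1 ψ) (leftFracInt (1 - μ) ψ) := by
  refine ⟨(memLp_top_leftFracInt (sub_pos.2 hμ1) hψ).mono_exponent le_top, fun φ hφ => ?_⟩
  have hd : MemLp (fun s => -deriv φ s) ⊤ vol01 := hφ.memLp_top_deriv.neg
  rw [rightCaputo, sub_sub_cancel, integral_leftFracInt_mul (sub_pos.2 hμ1) hψ
    ((memLp_top_rightFracInt hμ0 hd).integrable le_top),
    integral_leftFracInt_mul one_pos hψ (hφ.memLp_top_deriv.integrable le_top), ← integral_neg]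
  refine integral_congr_ae ?_
  filter_upwards [ae_vol01_mem_Icc] with x hx
  rw [rightFracInt_rightFracInt (sub_pos.2 hμ1) hμ0 hd hx, sub_add_cancel, rightFracInt_neg,
    mul_neg]

/-- Here φ must vanish at both ends: I^1 φ' = φ uses φ(0) = 0, and J^1 φ' = -φ uses φ(1) = 0. -/
theorem hasRightCaputoDeriv_primitive {μ : ℝ} (hμ0 : 0 < μ) (hμ1 : μ < 1) {ψ : ℝ → ℝ}
    (hψ : MemLp ψ ⊤ vol01) :
    HasRightCaputoDeriv μ (leftFracInt 1 ψ) (rightFracInt (1 - μ) fun s => -ψ s) := by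
  have hψ' : MemLp (fun s => -ψ s) ⊤ vol01 := hψ.neg
  refine ⟨(memLp_top_rightFracInt (sub_pos.2 hμ1) hψ').mono_exponent le_top, fun φ hφ => ?_⟩
  have hd := hφ.memLp_top_deriv
  rw [leftCaputo, sub_sub_cancel, integral_rightFracInt_mul (sub_pos.2 hμ1) hψ'
    ((memLp_top_leftFracInt hμ0 hd).integrable le_top),
    integral_leftFracInt_mul one_pos hψ (hd.integrable le_top)]
  refine integral_congr_ae ?_
  filter_upwards [ae_vol01_mem_Icc] with x hx
  rw [leftFracInt_leftFracInt (sub_pos.2 hμ1) hμ0 hd hx, sub_add_cancel,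
    hφ.leftFracInt_one_deriv, hφ.rightFracInt_one_deriv, neg_mul, mul_neg]

/-! ### The Dirichlet problem. -/

theorem integrableOn_Icc_of_integrable_vol01 {f : ℝ → ℝ} (hf : Integrable f vol01) :
    IntegrableOn f (uIcc 0 1) := by
  rw [uIcc_of_le zero_le_one, integrableOn_Icc_iff_integrableOn_Ioo]
  exact hf

theorem continuousOn_leftFracInt_one {f : ℝ → ℝ} (hf : Integrable f vol01) :
    ContinuousOn (leftFracInt 1 f) (Icc 0 1) := by
  have h := intervalIntegral.continuousOn_primitive_interval
    (integrableOn_Icc_of_integrable_vol01 hf)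
  rw [uIcc_of_le zero_le_one] at h
  exact h.congr fun x _ => leftFracInt_one f x

theorem continuousOn_rightFracInt_one {f : ℝ → ℝ} (hf : Integrable f vol01) :
    ContinuousOn (rightFracInt 1 f) (Icc 0 1) := by
  have h := intervalIntegral.continuousOn_primitive_interval_left
    (integrableOn_Icc_of_integrable_vol01 hf)
  rw [uIcc_of_le zero_le_one] at h
  exact h.congr fun x _ => rightFracInt_one f x

theorem memLp_top_of_continuousOn {w : ℝ → ℝ} (hw : ContinuousOn w (Icc 0 1)) :
    MemLp w ⊤ vol01 := by
  obtain ⟨M, hM⟩ := isCompact_Icc.exists_bound_of_continuousOn hw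
  refine memLp_top_of_bound
    ((hw.mono Ioo_subset_Icc_self).aestronglyMeasurable measurableSet_Ioo) M ?_
  filter_upwards [ae_vol01_mem_Icc] with x hx using hM x hx

theorem intervalIntegral_eq_integral_vol01 (f : ℝ → ℝ) :
    ∫ x in (0 : ℝ)..1, f x = ∫ x, f x ∂vol01 := by
  rw [intervalIntegral.integral_of_le zero_le_one, integral_Ioc_eq_integral_Ioo]
  rfl

theorem IsTestFunction.integral_deriv_eq_zero {φ : ℝ → ℝ} (hφ : IsTestFunction φ) :
    ∫ x, deriv φ x ∂vol01 = 0 := by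
  rw [← intervalIntegral_eq_integral_vol01, hφ.integral_deriv, hφ.eq_zero_of_notMem (by simp),
    hφ.eq_zero_of_notMem (by simp), sub_zero]

theorem IsTestFunction.integral_id_mul_deriv {φ : ℝ → ℝ} (hφ : IsTestFunction φ) :
    ∫ x, x * deriv φ x ∂vol01 = -∫ x, φ x ∂vol01 := by
  have h := integral_leftFracInt_mul one_pos (a := fun _ => 1) (memLp_const 1)
    (hφ.memLp_top_deriv.integrable le_top)
  simp_rw [leftFracInt_one, hφ.rightFracInt_one_deriv] at h
  simpa [integral_neg] using h

/-- The solution of the Dirichlet problem. -/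
noncomputable def dirichletSolution (f : ℝ → ℝ) (a₁ x : ℝ) : ℝ := a₁ + rightFracInt 1 f x

section Dirichlet

variable {f : ℝ → ℝ} {a₀ a₁ : ℝ}

theorem continuousOn_dirichletSolution (hf : Integrable f vol01) (a₁ : ℝ) :
    ContinuousOn (dirichletSolution f a₁) (Icc 0 1) :=
  continuousOn_const.add (continuousOn_rightFracInt_one hf)

theorem dirichletSolution_one (f : ℝ → ℝ) (a₁ : ℝ) : dirichletSolution f a₁ 1 = a₁ := by
  simp [dirichletSolution, rightFracInt_one]

theorem dirichletSolution_zero (h : (∫ x, f x ∂vol01) + a₁ - a₀ = 0) :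
    dirichletSolution f a₁ 0 = a₀ := by
  rw [dirichletSolution, rightFracInt_one, intervalIntegral_eq_integral_vol01]
  linarith

/-- The right side here is the load of the weak Caputo equation at v = I^1 ψ, for which v(1) = ∫ ψ
and v(0) = 0. -/
theorem integral_dirichletSolution_mul (hf : Integrable f vol01) (a₁ : ℝ) {ψ : ℝ → ℝ}
    (hψ : MemLp ψ ⊤ vol01) :
    ∫ x, dirichletSolution f a₁ x * ψ x ∂vol01 =
      a₁ * ∫ x, ψ x ∂vol01 + ∫ x, f x * leftFracInt 1 ψ x ∂vol01 := by
  have h := integral_leftFracInt_mul one_pos hψ hf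
  simp_rw [mul_comm (f _), h, dirichletSolution, add_mul, mul_comm (rightFracInt _ _ _)]
  have hr : Integrable (rightFracInt 1 f) vol01 :=
    (memLp_top_of_continuousOn (continuousOn_rightFracInt_one hf)).integrable le_top
  rw [integral_add ((hψ.integrable le_top).const_mul a₁)
    ((integrable_mul_of_memLp_top hr hψ).congr (ae_of_all _ fun x => mul_comm _ _)),
    integral_const_mul]

theorem integral_dirichletSolution_mul_deriv (hf : Integrable f vol01) (a₁ : ℝ) {φ : ℝ → ℝ}
    (hφ : IsTestFunction φ) :
    ∫ x, dirichletSolution f a₁ x * deriv φ x ∂vol01 = ∫ x, f x * φ x ∂vol01 := by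
  rw [integral_dirichletSolution_mul hf a₁ hφ.memLp_top_deriv, hφ.integral_deriv_eq_zero, mul_zero,
    zero_add]
  simp_rw [hφ.leftFracInt_one_deriv]

theorem isDirichletSolution_dirichletSolution (hf : MemLp f 2 vol01)
    (h : (∫ x, f x ∂vol01) + a₁ - a₀ = 0) :
    IsDirichletSolution f a₀ a₁ (dirichletSolution f a₁) := by
  have hfi : Integrable f vol01 := hf.integrable (by norm_num)
  have hc := continuousOn_dirichletSolution hfi a₁
  refine ⟨⟨fun x => -f x, ⟨(memLp_top_of_continuousOn hc).mono_exponent le_top, hf.neg, ?_⟩, ?_⟩,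
    _, ⟨hc, ae_eq_refl _⟩, dirichletSolution_zero h, dirichletSolution_one f a₁⟩
  · intro φ hφ
    rw [integral_dirichletSolution_mul_deriv hfi a₁ hφ, ← integral_neg]
    simp_rw [neg_mul]
  · intro φ _
    rw [← integral_neg]
    simp_rw [neg_mul]

/-- Two applications of du Bois-Reymond show that w - W is affine, C x + D; the boundary values then
force C = D = 0. -/
theorem IsDirichletSolution.ae_eq_dirichletSolution (hf : MemLp f 2 vol01)
    (h : (∫ x, f x ∂vol01) + a₁ - a₀ = 0) {w : ℝ → ℝ} (hw : IsDirichletSolution f a₀ a₁ w) :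
    w =ᵐ[vol01] dirichletSolution f a₁ := by
  obtain ⟨⟨dw, hdw, hweak⟩, wc, hwc, hw0, hw1⟩ := hw
  have hfi : Integrable f vol01 := hf.integrable (by norm_num)
  have hdi : Integrable dw vol01 := hdw.memLp_deriv.integrable (by norm_num)
  have hwi : Integrable w vol01 := hdw.memLp.integrable (by norm_num)
  have hc := continuousOn_dirichletSolution hfi a₁
  have hWi : Integrable (dirichletSolution f a₁) vol01 :=
    (memLp_top_of_continuousOn hc).integrable le_top
  have hid : Integrable (fun x : ℝ => x) vol01 :=
    (memLp_top_of_continuousOn continuousOn_id).integrable le_top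
  obtain ⟨C, hC⟩ := ae_eq_const_of_integral_mul_deriv_eq_zero (hdi.add hfi) fun φ hφ => by
    have hd := hφ.memLp_top_deriv
    simp_rw [Pi.add_apply, add_mul]
    rw [integral_add (integrable_mul_of_memLp_top hdi hd) (integrable_mul_of_memLp_top hfi hd),
      hweak φ hφ, neg_add_cancel]
  obtain ⟨D, hD⟩ := ae_eq_const_of_integral_mul_deriv_eq_zero
      ((hwi.sub hWi).sub (hid.const_mul C)) fun φ hφ => by
    have hd := hφ.memLp_top_deriv
    have hφt := hφ.memLp_top
    simp_rw [Pi.sub_apply, sub_mul, mul_assoc]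
    have hsub : Integrable (fun x => w x * deriv φ x - dirichletSolution f a₁ x * deriv φ x)
        vol01 := (integrable_mul_of_memLp_top hwi hd).sub (integrable_mul_of_memLp_top hWi hd)
    rw [integral_sub hsub ((integrable_mul_of_memLp_top hid hd).const_mul C),
      integral_sub (integrable_mul_of_memLp_top hwi hd) (integrable_mul_of_memLp_top hWi hd),
      integral_const_mul, hφ.integral_id_mul_deriv, integral_dirichletSolution_mul_deriv hfi a₁ hφ]
    have h1 := hdw.weak φ hφ
    have h2 : ∫ x, dw x * φ x ∂vol01 + ∫ x, f x * φ x ∂vol01 = C * ∫ x, φ x ∂vol01 := by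
      rw [← integral_add (integrable_mul_of_memLp_top hdi hφt)
        (integrable_mul_of_memLp_top hfi hφt), ← integral_const_mul]
      refine integral_congr_ae ?_
      filter_upwards [hC] with x hx
      rw [← hx, Pi.add_apply, add_mul]
    linarith
  -- Continuity upgrades almost everywhere equality to all of [0,1], so the endpoints can be
  -- evaluated.
  have hEq : EqOn wc (fun x => dirichletSolution f a₁ x + C * x + D) (Icc 0 1) := by
    refine Measure.eqOn_Icc_of_ae_eq volume zero_ne_one ?_ hwc.cont (by fun_prop)
    rw [← restrict_Ioo_eq_restrict_Icc]
    filter_upwards [hwc.ae_eq, hD] with x h1 h2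
    simp only [Pi.sub_apply] at h2
    linarith
  have e0 := hEq (left_mem_Icc.2 zero_le_one)
  have e1 := hEq (right_mem_Icc.2 zero_le_one)
  simp only [hw0, hw1, dirichletSolution_zero h, dirichletSolution_one] at e0 e1
  filter_upwards [hD] with x hx
  simp only [Pi.sub_apply] at hx
  have hD0 : D = 0 := by linarith
  have hC0 : C = 0 := by linarith
  rw [hD0, hC0] at hx
  linarith

end Dirichlet

/-! ### The representation of weak solutions. -/

theorem IsWeakSolution.ae_eq_leftFracInt_add_const {β : ℝ} (hβ0 : 0 < β) (hβ1 : β < 1)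
    {f u : ℝ → ℝ} {a₀ a₁ : ℝ} (hf : Integrable f vol01) (hu : IsWeakSolution β f a₀ a₁ u) :
    ∃ c, u =ᵐ[vol01] fun x => leftFracInt (1 - β) (dirichletSolution f a₁) x + c := by
  obtain ⟨hu2, g, hg, hweak⟩ := hu
  have hui : Integrable u vol01 := hu2.integrable (by norm_num)
  have hc := continuousOn_dirichletSolution hf a₁
  have hβ' : 0 < 1 - β := by linarith
  have hμ0 : 0 < 1 - β / 2 := by linarith
  have hμ1 : 1 - β / 2 < 1 := by linarith
  have hW := memLp_top_of_continuousOn hc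
  have hI : MemLp (leftFracInt (1 - β) (dirichletSolution f a₁)) ⊤ vol01 :=
    memLp_top_leftFracInt hβ' hW
  obtain ⟨c, hc'⟩ := ae_eq_const_of_integral_mul_deriv_eq_zero
      (hui.sub (hI.integrable le_top)) fun φ hφ => by
    have hd := hφ.memLp_top_deriv
    have hψ := memLp_top_rightFracInt hβ' hd
    -- The test function is v = I^1 ψ with ψ = J^(1-β) φ'.
    have key := hweak _ _ _
      ⟨(memLp_top_leftFracInt one_pos hψ).mono_exponent le_top, _,
        hasLeftCaputoDeriv_primitive hμ0 hμ1 hψ⟩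
      ⟨continuousOn_leftFracInt_one (hψ.integrable le_top), ae_eq_refl _⟩
      (hasRightCaputoDeriv_primitive hμ0 hμ1 hψ)
    rw [leftFracInt_one _ 0, leftFracInt_one _ 1, intervalIntegral.integral_same,
      intervalIntegral_eq_integral_vol01, mul_zero, sub_zero, add_comm,
      ← integral_dirichletSolution_mul hf a₁ hψ, ← integral_neg] at key
    simp_rw [mul_comm (dirichletSolution f a₁ _)] at key
    rw [integral_rightFracInt_mul hβ' hd (hW.integrable le_top)] at key
    have hgw := hg.weak φ hφ
    rw [rightCaputo, sub_sub_cancel, neg_eq_iff_eq_neg.symm, ← integral_neg] at hgw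
    -- The orders add up as β/2 + (1 - β) = 1 - β/2, which matches the right Caputo derivative of φ
    -- in the definition of g.
    have hlink : ∫ x, -(g x * rightFracInt (1 - (1 - β / 2))
        (fun s => -rightFracInt (1 - β) (deriv φ) s) x) ∂vol01 =
        ∫ x, -(g x * rightFracInt (1 - β / 2) (fun s => -deriv φ s) x) ∂vol01 := by
      refine integral_congr_ae ?_
      filter_upwards [ae_vol01_mem_Icc] with x hx
      rw [rightFracInt_neg, rightFracInt_neg,
        rightFracInt_rightFracInt (by linarith) hβ' hd hx]
      ring_nf
    simp_rw [Pi.sub_apply, sub_mul]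
    rw [integral_sub (integrable_mul_of_memLp_top hui hd)
      (integrable_mul_of_memLp_top (hI.integrable le_top) hd), ← hgw, ← hlink, key]
    simp_rw [mul_comm (deriv φ _)]
    exact sub_self _
  refine ⟨c, ?_⟩
  filter_upwards [hc'] with x hx
  simp only [Pi.sub_apply] at hx
  linarith

end CaputoNeumann

theorem mainTheorem11 (β : ℝ) (hβ0 : 0 < β) (hβ1 : β < 1) (f : ℝ → ℝ) (a₀ a₁ : ℝ)
    (hf : MemLp f 2 CaputoNeumann.vol01)
    (hconstraint : (∫ x, f x ∂CaputoNeumann.vol01) + a₁ - a₀ = 0)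
    (u : ℝ → ℝ) (hu : CaputoNeumann.IsWeakSolution β f a₀ a₁ u) :
    ∃ uc w : ℝ → ℝ,
      CaputoNeumann.IsContRep u uc ∧
      CaputoNeumann.IsDirichletSolution f a₀ a₁ w ∧
      (∀ w' : ℝ → ℝ, CaputoNeumann.IsDirichletSolution f a₀ a₁ w' →
        w' =ᵐ[CaputoNeumann.vol01] w) ∧
      ∀ x ∈ Icc (0 : ℝ) 1,
        uc x = CaputoNeumann.leftFracInt (1 - β) w x + uc 0 := by
  have hfi : Integrable f CaputoNeumann.vol01 := hf.integrable (by norm_num)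
  obtain ⟨c, hc⟩ := hu.ae_eq_leftFracInt_add_const hβ0 hβ1 hfi
  refine ⟨_, CaputoNeumann.dirichletSolution f a₁, ⟨?_, hc⟩,
    CaputoNeumann.isDirichletSolution_dirichletSolution hf hconstraint,
    fun w' hw' => hw'.ae_eq_dirichletSolution hf hconstraint, fun x _ => ?_⟩
  · exact (CaputoNeumann.continuousOn_leftFracInt (by linarith)
      (CaputoNeumann.continuousOn_dirichletSolution hfi a₁)).add continuousOn_const
  -- At 0 the fractional integral is over an empty interval, so the constant is the value of the
  -- representative there.
  · simp [CaputoNeumann.leftFracInt]
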